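/- Proposition 2. Let $\mathcal M$ be an acyclic structural causal model (SCM) with finitely many endogenous variables: features $X=(X_d)_{d\in D}$ and a target $Y$, taking values in measurable spaces with measurable singletons, the space of $Y$ being preordered. Let $U=(U_d)_{d\in D\cup\{Y\}}$ be its mutually independent exogenous variables with joint law $P$; the (measurable) structural equations determine each variable from its parents in the causal graph $\mathcal G$ and its own exogenous variable, and solving them gives $\mathbb F:u\mapsto(x,y)$. An action $a=do(\{X_i:=a_i\}_{i\in I_a})$ replaces the structural equations of the variables in $I_a$ by the constants $a_i$; $\mathbb F_a$ is the solution map of the resulting SCM. Let $\mathbb A$ be a set of actions. Let $\mathrm{Causes}(Y)$ be the set of ancestors of $Y$ in $\mathcal G$, and call $l\in\mathrm{Causes}(Y)$ an actionable cause if $l\in I_a$ for some $a\in\mathbb A$. For an individual with exogenous values $u^F$, write $(x^F,y^F)=\mathbb F(u^F)$. Let the predictor $f$ assign to every feature vector a value in the space of $Y$. Assume: (i) $f$ is perfect in the pre-recourse distribution, i.e. $f(X)=Y$ $P$-almost surely; (ii) $f(x)$ depends only on $x_S$ for a set $S\subseteq D$; (iii) $S$ is stable with respect to interventions on the actionable causes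 of $Y$: in the graph $\mathcal G^*$ obtained from $\mathcal G$ by adding, for each actionable cause $l$, a parentless node $\mathcal I_l$ with the single edge $\mathcal I_l\to l$, every $\mathcal I_l$ is $d$-separated from $Y$ by $S$. Then for $P$-almost every $u^F$ the following holds. Let $\mathbb F^{-1}$ be an abduction map with $\mathbb F^{-1}(x^F)=u^F$; for an action $a$ let $(x^{SCF,a},y^{SCF,a})=\mathbb F_a(\mathbb F^{-1}(x^F))$ be the structural counterfactual and $\hat y^{SCF,a}=f(x^{SCF,a})$ its prediction. Let $a$ be a recommendation of effective actionable recourse (EAR) for $x^F$, i.e. for some cost function and some threshold $t$, $a$ minimises $\mathrm{cost}(\cdot,x^F)$ over the actions $b\in\mathbb A$ with $I_b\subseteq\mathrm{Causes}(Y)$ and $f(x^{SCF,b})\ge t$. If $P(X_S=x_S^{SCF,a})>0$, then $$\hat y^{SCF,a}=y^{SCF,a}.$$ -/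

import Mathlib

open MeasureTheory

/-! ### Directed graphs: causes, d-separation, intervention stability -/

/-- `w` is a (direct or indirect) cause of `v` if there is a directed path with at least one edge
from `w` to `v`. -/
def Digraph.causes {V : Type*} (G : Digraph V) (v : V) : Set V :=
  {w | Relation.TransGen G.Adj w v}

/-- The middle node `m` of the consecutive nodes `i, m, j` of a path blocks the path given `Z`:
either `i, m, j` is a chain (in one of the two directions) or a fork and `m ∈ Z`, or it is a
collider and neither `m` nor any descendant of `m` lies in `Z`. -/
def Digraph.BlocksAt {V : Type*} (G : Digraph V) (Z : Set V) (i m j : V) : Prop :=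
  (((G.Adj i m ∧ G.Adj m j) ∨ (G.Adj j m ∧ G.Adj m i) ∨ (G.Adj m i ∧ G.Adj m j)) ∧ m ∈ Z) ∨
  ((G.Adj i m ∧ G.Adj j m) ∧ ∀ n, Relation.ReflTransGen G.Adj m n → n ∉ Z)

/-- d-separation of the node sets `A` and `B` by `Z`: every path (in the underlying undirected
graph, without repeated nodes) from a node of `A` to a node of `B` is blocked by `Z`. -/
def Digraph.DSep {V : Type*} (G : Digraph V) (A B Z : Set V) : Prop :=
  ∀ a ∈ A, ∀ b ∈ B, ∀ p : G.toSimpleGraphInclusive.Walk a b, p.IsPath →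
    ∃ i m j, [i, m, j] <:+: p.support ∧ G.BlocksAt Z i m j

/-- The augmented graph: for every `l ∈ L` a parentless intervention node `Sum.inr l` is added,
with the single edge `Sum.inr l → Sum.inl l`. -/
def Digraph.augment {V : Type*} (G : Digraph V) (L : Set V) : Digraph (V ⊕ L) where
  Adj
    | Sum.inl v, Sum.inl w => G.Adj v w
    | Sum.inr l, Sum.inl w => (l : V) = w
    | _, Sum.inr _ => False

/-- `S` is intervention stable for the target `y` with respect to interventions on the variables
in `L`: in the augmented graph, `S` d-separates every intervention node from `y`. -/
def Digraph.InterventionStable {V : Type*} (G : Digraph V) (y : V) (S L : Set V) : Prop :=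
  ∀ l : L, (G.augment L).DSep {Sum.inr l} {Sum.inl y} (Sum.inl '' S)

/-! ### Structural causal models -/

/-- A structural causal model with endogenous variables `X_v ∈ Ω v` and exogenous variables
`U_v ∈ U v`, `v ∈ V`: a directed acyclic graph, for every `v` a structural equation that determines
`X_v` from the parents of `v` and from `U_v`, and the distributions of the exogenous variables. -/
structure SCM (V : Type*) (Ω U : V → Type*)
    [∀ v, MeasurableSpace (Ω v)] [∀ v, MeasurableSpace (U v)] where
  /-- the causal graph -/
  graph : Digraph V
  acyclic : ∀ v, ¬ Relation.TransGen graph.Adj v v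
  /-- the structural equations -/
  eqn : ∀ v, (∀ w : {w // graph.Adj w v}, Ω w) → U v → Ω v
  measurable_eqn : ∀ v, Measurable fun p : (∀ w : {w // graph.Adj w v}, Ω w) × U v => eqn v p.1 p.2
  /-- the distributions of the exogenous variables -/
  law : ∀ v, Measure (U v)
  isProbabilityMeasure_law : ∀ v, IsProbabilityMeasure (law v)

/-- The action `do({X_i := a_i}_{i ∈ I})`. -/
structure DoAction {V : Type*} (Ω : V → Type*) where
  /-- the set `I` of variables that are intervened upon -/
  targets : Set V
  /-- the values `a_i` -/
  value : ∀ i : targets, Ω i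

namespace SCM

variable {V : Type*} {Ω U : V → Type*} [∀ v, MeasurableSpace (Ω v)] [∀ v, MeasurableSpace (U v)]

/-- The joint distribution of the mutually independent exogenous variables. -/
noncomputable def exo [Fintype V] (M : SCM V Ω U) : Measure (∀ v, U v) :=
  Measure.pi M.law

theorem wellFounded_adj [Finite V] (M : SCM V Ω U) : WellFounded M.graph.Adj := by
  have : IsTrans V (Relation.TransGen M.graph.Adj) := ⟨fun _ _ _ h k => h.trans k⟩
  have : Std.Irrefl (Relation.TransGen M.graph.Adj) := ⟨M.acyclic⟩
  exact Subrelation.wf (fun h => Relation.TransGen.single h)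
    (Finite.wellFounded_of_trans_of_irrefl (Relation.TransGen M.graph.Adj))

/-- The map `𝔽` from exogenous to endogenous values that is given by the structural equations,
solved along the graph. -/
noncomputable def solve [Finite V] (M : SCM V Ω U) (u : ∀ v, U v) : ∀ v, Ω v :=
  M.wellFounded_adj.fix fun v ih => M.eqn v (fun w => ih w w.2) (u v)

theorem solve_eq [Finite V] (M : SCM V Ω U) (u : ∀ v, U v) (v : V) :
    M.solve u v = M.eqn v (fun w => M.solve u w) (u v) :=
  M.wellFounded_adj.fix_eq _ v

open Classical in
/-- The intervened model: the structural equations of the targets of the action are replaced by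
the constants that the action prescribes, and the edges into the targets are removed. -/
noncomputable def intervene (M : SCM V Ω U) (a : DoAction Ω) : SCM V Ω U where
  graph := { Adj := fun w v => M.graph.Adj w v ∧ v ∉ a.targets }
  acyclic v h := M.acyclic v (h.lift id fun _ _ h => h.1)
  eqn v x u :=
    if h : v ∈ a.targets then a.value ⟨v, h⟩ else M.eqn v (fun w => x ⟨w, w.2, h⟩) u
  measurable_eqn v := by
    by_cases h : v ∈ a.targets
    · simp only [h, dite_true]
      exact measurable_const
    · simp only [h, dite_false]
      refine (M.measurable_eqn v).comp (Measurable.prodMk ?_ measurable_snd)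
      exact measurable_pi_lambda _ fun w => (measurable_pi_apply _).comp measurable_fst
  law := M.law
  isProbabilityMeasure_law := M.isProbabilityMeasure_law

end SCM

/-! ### Recourse: the features are indexed by `D`, the target `Y` is the node `none` -/

/-- The feature part `x` of a value `(x, y)` of all endogenous variables. -/
def features {D : Type*} {Ω : Option D → Type*} (z : ∀ v, Ω v) : ∀ d, Ω (some d) :=
  fun d => z (some d)

namespace SCM

variable {D : Type*} {Ω U : Option D → Type*}
  [∀ v, MeasurableSpace (Ω v)] [∀ v, MeasurableSpace (U v)]

/-- The structural counterfactual `(x, y) = 𝔽_a(𝔽⁻¹(x^F))` (features and target) of an individual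
with features `xF` under the action `a`, where `inv` is the abduction map `𝔽⁻¹`. -/
noncomputable def counterfactual [Finite D] (M : SCM (Option D) Ω U)
    (inv : (∀ d, Ω (some d)) → ∀ v, U v) (xF : ∀ d, Ω (some d)) (a : DoAction Ω) : ∀ v, Ω v :=
  (M.intervene a).solve (inv xF)

/-- The actionable causes of the target: its causes that some action of the action space
intervenes upon. -/
def actionableCauses (M : SCM (Option D) Ω U) (𝔸 : Set (DoAction Ω)) : Set (Option D) :=
  {l | l ∈ M.graph.causes none ∧ ∃ a ∈ 𝔸, l ∈ a.targets}

/-- The actions that effective actionable recourse allows: actions of the action space that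
intervene on causes of the target only and whose counterfactual prediction reaches `t`. -/
def earAllowed [Finite D] [LE (Ω none)] (M : SCM (Option D) Ω U) (𝔸 : Set (DoAction Ω))
    (f : (∀ d, Ω (some d)) → Ω none) (t : Ω none)
    (inv : (∀ d, Ω (some d)) → ∀ v, U v) (xF : ∀ d, Ω (some d)) : Set (DoAction Ω) :=
  {a | a ∈ 𝔸 ∧ a.targets ⊆ M.graph.causes none ∧ t ≤ f (features (M.counterfactual inv xF a))}

/-- A recommendation of effective actionable recourse (EAR): an allowed action of minimal cost. -/
def IsEARRecommendation [Finite D] [LE (Ω none)] (M : SCM (Option D) Ω U) (𝔸 : Set (DoAction Ω))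
    (cost : DoAction Ω → (∀ d, Ω (some d)) → ℝ)
    (f : (∀ d, Ω (some d)) → Ω none) (t : Ω none)
    (inv : (∀ d, Ω (some d)) → ∀ v, U v) (xF : ∀ d, Ω (some d)) (a : DoAction Ω) : Prop :=
  a ∈ M.earAllowed 𝔸 f t inv xF ∧ ∀ b ∈ M.earAllowed 𝔸 f t inv xF, cost a xF ≤ cost b xF

end SCM

/-!
The argument conditions on `X_S = x` by clamping: every variable in `S` is made to pass a fixed value
`x s` on to its children, and `SCM.response` is what the structural equation of a node then yields.
The event `X_S = x` says that the responses of the nodes `s ∈ S` agree with the `x s`, and on it all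
variables coincide with their responses.

Take the arrows `w → v` with `w ∉ S` into ancestors of `S` or of the target, forget the directions,
and let `C` be the connected component of the target and `T` the rest of the ancestors. Both are
closed under parents outside `S`, so the responses on `C` and on `T` are functions of the disjoint
families `U_C` and `U_T` and hence independent. If `X_S = x` has positive probability, the
constraints in `T` therefore hold with positive probability independently of what happens in `C`, and
`Y = f(x)` given `X_S = x` already follows, almost surely, from the constraints in `C` alone
(`SCM.ae_response_eq`). The exceptional null set depends on `x` only, and there are countably many
such `x`.

Intervention stability implies that no actionable cause lies in `C`
(`Digraph.InterventionStable.exists_separation`): a path in the component can be blocked at colliders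
only, and rerouting it at its first node that is an ancestor of the target but not of `S` turns it
into an unblocked path. So an action leaves the structural equations on `C` untouched. On `C` the
counterfactual is thus given by the responses to its own values `x` on `S`
(`SCM.eq_response`); in particular it satisfies the constraints in `C`, and its target is `f(x)`.
-/

/-! ### d-separation and the connected component of the target -/

namespace Digraph

variable {V : Type*} {G : Digraph V} {Z : Set V} {a b : V}

/-- The undirected graph whose edges are the arrows `x → y` of `G` with `x ∉ Z` and with `y` an
ancestor of `b` or of `Z` (every node counting as its own ancestor). On a path in this graph no
non-collider lies in `Z`, and every collider is an ancestor of `b` or of `Z`. -/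
def openGraph (G : Digraph V) (Z : Set V) (b : V) : SimpleGraph V :=
  SimpleGraph.fromRel fun x y =>
    G.Adj x y ∧ x ∉ Z ∧ ∃ n ∈ insert b Z, Relation.ReflTransGen G.Adj y n

/-- The ancestors of `b` that are not ancestors of any node in `Z`. -/
def freeAncestors (G : Digraph V) (Z : Set V) (b : V) : Set V :=
  {x | Relation.ReflTransGen G.Adj x b ∧ ∀ n ∈ Z, ¬ Relation.ReflTransGen G.Adj x n}

theorem openGraph_le : G.openGraph Z b ≤ G.toSimpleGraphInclusive := by
  rintro x y ⟨hne, h | h⟩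
  · exact ⟨hne, Or.inl h.1⟩
  · exact ⟨hne, Or.inr h.1⟩

theorem openGraph_adj_of_adj (hG : ∀ v, ¬ Relation.TransGen G.Adj v v) {x y n : V}
    (h : G.Adj x y) (hx : x ∉ Z) (hn : n ∈ insert b Z)
    (hy : Relation.ReflTransGen G.Adj y n) : (G.openGraph Z b).Adj x y :=
  ⟨fun e => hG y (.single (e ▸ h)), Or.inl ⟨h, hx, n, hn, hy⟩⟩

theorem notMem_of_openGraph_adj (hG : ∀ v, ¬ Relation.TransGen G.Adj v v) {x y : V}
    (h : (G.openGraph Z b).Adj x y) (hxy : G.Adj x y) : x ∉ Z := by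
  obtain ⟨-, h | h⟩ := h
  · exact h.2.1
  · exact absurd ((Relation.TransGen.single hxy).tail h.1) (hG x)

theorem ancestor_of_openGraph_adj {x y : V} (h : (G.openGraph Z b).Adj x y) :
    ∃ n ∈ insert b Z, Relation.ReflTransGen G.Adj x n := by
  obtain ⟨-, h | h⟩ := h
  · obtain ⟨n, hn, hyn⟩ := h.2.2
    exact ⟨n, hn, .head h.1 hyn⟩
  · exact h.2.2

/-- From a free ancestor of `b`, the directed path down to `b` stays among the free ancestors. -/
theorem exists_directed_path (hG : ∀ v, ¬ Relation.TransGen G.Adj v v)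
    (hab : Relation.ReflTransGen G.Adj a b) (ha : a ∈ G.freeAncestors Z b) :
    ∃ q : (G.openGraph Z b).Walk a b, q.IsPath ∧
      (∀ x ∈ q.support, x ∈ G.freeAncestors Z b ∧ Relation.ReflTransGen G.Adj a x) ∧
      q.support.IsChain G.Adj := by
  induction hab using Relation.ReflTransGen.head_induction_on with
  | refl => exact ⟨.nil, by simp, by simpa using ⟨ha, .refl⟩, by simp⟩
  | @head a c hac hcb ih =>
    obtain ⟨q, hq, hsupp, hchain⟩ := ih ⟨hcb, fun n hn h => ha.2 n hn (.head hac h)⟩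
    have hadj : (G.openGraph Z b).Adj a c :=
      openGraph_adj_of_adj hG hac (fun h => ha.2 a h .refl) (Set.mem_insert _ _) hcb
    refine ⟨.cons hadj q, ?_, ?_, ?_⟩
    · rw [SimpleGraph.Walk.cons_isPath_iff]
      exact ⟨hq, fun h => hG a (.head' hac (hsupp a h).2)⟩
    · intro x hx
      rw [SimpleGraph.Walk.support_cons, List.mem_cons] at hx
      obtain rfl | hx := hx
      · exact ⟨ha, .refl⟩
      · exact ⟨(hsupp x hx).1, .head hac (hsupp x hx).2⟩
    · rw [SimpleGraph.Walk.support_cons, ← SimpleGraph.Walk.cons_tail_support]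
      rw [← SimpleGraph.Walk.cons_tail_support] at hchain
      exact List.isChain_cons_cons.2 ⟨hac, hchain⟩

/-- Rerouting a path at its first free ancestor of `b` makes all free ancestors on it point
towards `b`. In particular none of them is a collider any more. -/
theorem exists_rerouted_path (hG : ∀ v, ¬ Relation.TransGen G.Adj v v)
    (p : (G.openGraph Z b).Walk a b) (hp : p.IsPath) :
    ∃ q : (G.openGraph Z b).Walk a b, q.IsPath ∧
      (∀ x ∈ q.support, x ∈ p.support ∨ x ∈ G.freeAncestors Z b) ∧
      q.support.IsChain fun x y => x ∈ G.freeAncestors Z b → G.Adj x y := by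
  -- the endpoint is kept apart from the parameter `b` of the graph for the induction
  suffices key : ∀ {a c : V} (p : (G.openGraph Z b).Walk a c), c = b → p.IsPath →
      ∃ q : (G.openGraph Z b).Walk a c, q.IsPath ∧
        (∀ x ∈ q.support, x ∈ p.support ∨ x ∈ G.freeAncestors Z b) ∧
        q.support.IsChain fun x y => x ∈ G.freeAncestors Z b → G.Adj x y from key p rfl hp
  intro a c p hc hp
  induction p with
  | nil => exact ⟨.nil, by simp, by simp, by simp⟩
  | @cons a d c had p ih =>
    by_cases ha : a ∈ G.freeAncestors Z b
    · subst hc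
      obtain ⟨q, hq, hsupp, hchain⟩ := exists_directed_path hG ha.1 ha
      exact ⟨q, hq, fun x hx => Or.inr (hsupp x hx).1, hchain.imp fun _ _ h _ => h⟩
    · rw [SimpleGraph.Walk.cons_isPath_iff] at hp
      obtain ⟨q, hq, hsupp, hchain⟩ := ih hc hp.1
      refine ⟨.cons had q, ?_, ?_, ?_⟩
      · rw [SimpleGraph.Walk.cons_isPath_iff]
        exact ⟨hq, fun h => (hsupp a h).elim hp.2 ha⟩
      · intro x hx
        rw [SimpleGraph.Walk.support_cons, List.mem_cons] at hx ⊢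
        obtain rfl | hx := hx
        · exact Or.inl (Or.inl rfl)
        · exact (hsupp x hx).imp Or.inr id
      · rw [SimpleGraph.Walk.support_cons, ← SimpleGraph.Walk.cons_tail_support]
        rw [← SimpleGraph.Walk.cons_tail_support] at hchain
        exact List.isChain_cons_cons.2 ⟨fun h => absurd h ha, hchain⟩

/-- d-separated nodes lie in different components of the open graph. -/
theorem DSep.not_reachable (hG : ∀ v, ¬ Relation.TransGen G.Adj v v)
    (h : G.DSep {a} {b} Z) : ¬ (G.openGraph Z b).Reachable a b := by
  intro hr
  obtain ⟨p, hp⟩ := hr.exists_isPath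
  obtain ⟨q, hq, -, hchain⟩ := exists_rerouted_path hG p hp
  obtain ⟨i, m, j, hinf, hblock⟩ := h a rfl b rfl (q.mapLe openGraph_le)
    ((SimpleGraph.Walk.isPath_mapLe openGraph_le).2 hq)
  rw [SimpleGraph.Walk.support_mapLe_eq_support] at hinf
  have hadj := q.isChain_adj_support.infix hinf
  have hfree := hchain.infix hinf
  simp only [List.isChain_cons_cons, List.isChain_singleton, and_true] at hadj hfree
  obtain ⟨⟨-, h⟩ | ⟨-, h⟩ | ⟨h, -⟩, hm⟩ | ⟨⟨him, hjm⟩, hm⟩ := hblock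
  · exact notMem_of_openGraph_adj hG hadj.2 h hm
  · exact notMem_of_openGraph_adj hG hadj.1.symm h hm
  · exact notMem_of_openGraph_adj hG hadj.1.symm h hm
  · -- a collider that is no ancestor of `Z` is a free ancestor of `b`, so its arrow points to `j`
    obtain ⟨n, hn, hmn⟩ := ancestor_of_openGraph_adj hadj.2
    obtain rfl | hn := hn
    · exact hG m (.head (hfree.2 ⟨hmn, fun n hn h => hm n h hn⟩) (.single hjm))
    · exact hm n hmn hn

/-! ### The augmented graph -/

variable {L : Set V}

theorem augment_reflTransGen {x y : V} (h : Relation.ReflTransGen G.Adj x y) :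
    Relation.ReflTransGen (G.augment L).Adj (Sum.inl x) (Sum.inl y) :=
  Relation.ReflTransGen.lift (p := (G.augment L).Adj) Sum.inl (fun _ _ h => h) x y h

theorem transGen_of_augment {x : V} {z : V ⊕ L}
    (h : Relation.TransGen (G.augment L).Adj (Sum.inl x) z) :
    ∃ y, z = Sum.inl y ∧ Relation.TransGen G.Adj x y := by
  induction h with
  | @single z h =>
    cases z with
    | inl y => exact ⟨y, rfl, .single h⟩
    | inr l => exact h.elim
  | @tail w z _ h ih =>
    obtain ⟨y, rfl, hy⟩ := ih
    cases z with
    | inl y' => exact ⟨y', rfl, hy.tail h⟩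
    | inr l => exact h.elim

theorem augment_acyclic (hG : ∀ v, ¬ Relation.TransGen G.Adj v v) (z : V ⊕ L) :
    ¬ Relation.TransGen (G.augment L).Adj z z := by
  intro h
  cases z with
  | inl x =>
    obtain ⟨y, hxy, h⟩ := transGen_of_augment h
    cases hxy
    exact hG x h
  | inr l =>
    obtain ⟨w, -, hw⟩ := Relation.TransGen.tail'_iff.1 h
    cases w <;> exact hw.elim

/-- Intervention stability yields disjoint sets `C ∋ y` and `T`, covering
`S` and each closed under the parents outside `S`, such that no node of `L` lies in `C`. -/
theorem InterventionStable.exists_separation (hG : ∀ v, ¬ Relation.TransGen G.Adj v v) {y : V}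
    {S : Set V} (hL : L ⊆ G.causes y) (h : G.InterventionStable y S L) :
    ∃ C T : Set V, y ∈ C ∧ S ⊆ C ∪ T ∧ Disjoint C T ∧ Disjoint L C ∧
      (∀ v ∈ C, ∀ w, G.Adj w v → w ∉ S → w ∈ C) ∧
      (∀ v ∈ T, ∀ w, G.Adj w v → w ∉ S → w ∈ T) := by
  set H := (G.augment L).openGraph (Sum.inl '' S) (Sum.inl y) with hH
  let A : Set V := {v | ∃ n ∈ insert y S, Relation.ReflTransGen G.Adj v n}
  have hA : ∀ w v, v ∈ A → G.Adj w v → w ∈ A := by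
    rintro w v ⟨n, hn, hv⟩ hwv
    exact ⟨n, hn, .head hwv hv⟩
  have hadj : ∀ z v, v ∈ A → (G.augment L).Adj z (Sum.inl v) → z ∉ Sum.inl '' S →
      H.Adj z (Sum.inl v) := by
    rintro z v ⟨n, hn, hv⟩ hzv hz
    refine openGraph_adj_of_adj (augment_acyclic hG) hzv hz ?_ (augment_reflTransGen hv)
    rw [← Set.image_insert_eq]
    exact Set.mem_image_of_mem _ hn
  have hadj' : ∀ w v, v ∈ A → G.Adj w v → w ∉ S → H.Adj (Sum.inl w) (Sum.inl v) :=
    fun w v hv hwv hw => hadj _ v hv hwv (by simpa using hw)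
  refine ⟨{v | v ∈ A ∧ H.Reachable (Sum.inl v) (Sum.inl y)},
    {v | v ∈ A ∧ ¬ H.Reachable (Sum.inl v) (Sum.inl y)},
    ⟨⟨y, Set.mem_insert _ _, .refl⟩, .rfl⟩, ?_, ?_, ?_, ?_, ?_⟩
  · intro s hs
    have : s ∈ A := ⟨s, Set.mem_insert_of_mem _ hs, .refl⟩
    by_cases hr : H.Reachable (Sum.inl s) (Sum.inl y)
    exacts [Or.inl ⟨this, hr⟩, Or.inr ⟨this, hr⟩]
  · exact Set.disjoint_left.2 fun v hv hv' => hv'.2 hv.2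
  · refine Set.disjoint_left.2 fun l hl hlC => ?_
    have hlA : l ∈ A := ⟨y, Set.mem_insert _ _, (hL hl).to_reflTransGen⟩
    have h1 : H.Adj (Sum.inr ⟨l, hl⟩) (Sum.inl l) := hadj _ l hlA rfl (by simp)
    exact (h ⟨l, hl⟩).not_reachable (augment_acyclic hG) (h1.reachable.trans hlC.2)
  · rintro v ⟨hv, hr⟩ w hwv hw
    exact ⟨hA w v hv hwv, (hadj' w v hv hwv hw).reachable.trans hr⟩
  · rintro v ⟨hv, hr⟩ w hwv hw
    exact ⟨hA w v hv hwv, fun h => hr ((hadj' w v hv hwv hw).symm.reachable.trans h)⟩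

end Digraph

/-! ### The model with the variables in `S` held fixed -/

namespace SCM

variable {V : Type*} {Ω U : V → Type*} [∀ v, MeasurableSpace (Ω v)] [∀ v, MeasurableSpace (U v)]

theorem measurable_solve [Finite V] (M : SCM V Ω U) : Measurable M.solve := by
  refine measurable_pi_lambda _ fun v => ?_
  induction v using M.wellFounded_adj.induction with
  | _ v ih =>
    simp_rw [M.solve_eq _ v]
    exact (M.measurable_eqn v).comp
      ((measurable_pi_lambda _ fun w : {w // M.graph.Adj w v} => ih w.1 w.2).prodMk (measurable_pi_apply v))

/-- The structural equations determine the endogenous variables uniquely. -/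
theorem eq_solve [Finite V] (M : SCM V Ω U) {u : ∀ v, U v} {z : ∀ v, Ω v}
    (hz : ∀ v, z v = M.eqn v (fun w => z w) (u v)) : z = M.solve u := by
  funext v
  induction v using M.wellFounded_adj.induction with
  | _ v ih =>
    rw [hz v, M.solve_eq u v]
    exact congrArg (M.eqn v · (u v)) (funext fun w => ih w w.2)

theorem intervene_solve_of_notMem [Finite V] (M : SCM V Ω U) (a : DoAction Ω) (u : ∀ v, U v)
    {v : V} (hv : v ∉ a.targets) :
    (M.intervene a).solve u v = M.eqn v (fun w => (M.intervene a).solve u w) (u v) := by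
  rw [solve_eq]
  simp [intervene, hv]

theorem intervene_solve_of_mem [Finite V] (M : SCM V Ω U) (a : DoAction Ω) (u : ∀ v, U v)
    {v : V} (hv : v ∈ a.targets) : (M.intervene a).solve u v = a.value ⟨v, hv⟩ := by
  rw [solve_eq]
  simp [intervene, hv]

variable [Finite V] (M : SCM V Ω U) {S : Set V} (x : ∀ s : S, Ω s)

/-- The value that the structural equation of `v` produces when every variable in `S` passes the
value prescribed by `x` on to its children. For `v ∈ S` it may differ from `x v`: the observed
variables in `S` have the values `x` if and only if the two agree for all `v ∈ S`. -/
noncomputable def response (u : ∀ v, U v) (v : V) : Ω v :=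
  M.eqn v (fun w => (M.intervene ⟨S, x⟩).solve u w) (u v)

theorem measurable_response (v : V) : Measurable fun u => M.response x u v :=
  (M.measurable_eqn v).comp ((measurable_pi_lambda _ fun _ =>
    (measurable_pi_apply _).comp (M.intervene ⟨S, x⟩).measurable_solve).prodMk
      (measurable_pi_apply v))

/-- On a set of nodes that is closed under the parents outside `S`, every solution of the
structural equations that takes the values `x` on `S` is given by the responses. -/
theorem eq_response {C : Set V} (hC : ∀ v ∈ C, ∀ w, M.graph.Adj w v → w ∉ S → w ∈ C)
    {u : ∀ v, U v} {z : ∀ v, Ω v} (hzS : ∀ s : S, z s = x s)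
    (hz : ∀ v ∈ C, z v = M.eqn v (fun w => z w) (u v)) :
    ∀ v ∈ C, z v = M.response x u v := by
  intro v
  induction v using M.wellFounded_adj.induction with
  | _ v ih =>
    intro hv
    rw [hz v hv, response]
    refine congrArg (M.eqn v · (u v)) (funext fun w => ?_)
    by_cases hw : (w : V) ∈ S
    · exact (hzS ⟨w, hw⟩).trans (M.intervene_solve_of_mem ⟨S, x⟩ u hw).symm
    · exact (ih w w.2 (hC v hv w w.2 hw)).trans
        (M.intervene_solve_of_notMem ⟨S, x⟩ u hw).symm

theorem dependsOn_response {C : Set V}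
    (hC : ∀ v ∈ C, ∀ w, M.graph.Adj w v → w ∉ S → w ∈ C) {v : V} (hv : v ∈ C) :
    DependsOn (fun u => M.response x u v) C := by
  intro u u' h
  induction v using M.wellFounded_adj.induction with
  | _ v ih =>
    simp only [response]
    rw [h v hv]
    refine congrArg (M.eqn v · (u' v)) (funext fun w => ?_)
    by_cases hw : (w : V) ∈ S
    · exact (M.intervene_solve_of_mem ⟨S, x⟩ u hw).trans
        (M.intervene_solve_of_mem ⟨S, x⟩ u' hw).symm
    · exact (M.intervene_solve_of_notMem ⟨S, x⟩ u hw).trans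
        ((ih w w.2 (hC v hv w w.2 hw)).trans (M.intervene_solve_of_notMem ⟨S, x⟩ u' hw).symm)

theorem solve_eq_response {u : ∀ v, U v} (h : ∀ s : S, M.solve u s = x s) (v : V) :
    M.solve u v = M.response x u v :=
  M.eq_response x (C := Set.univ) (by simp) h (fun v _ => M.solve_eq u v) v trivial

theorem solve_eq_of_response_eq {u : ∀ v, U v} (h : ∀ s : S, M.response x u s = x s) (s : S) :
    M.solve u s = x s := by
  have hz : (M.intervene ⟨S, x⟩).solve u = M.solve u := by
    refine M.eq_solve fun v => ?_
    by_cases hv : v ∈ S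
    · exact (M.intervene_solve_of_mem ⟨S, x⟩ u hv).trans (h ⟨v, hv⟩).symm
    · exact M.intervene_solve_of_notMem ⟨S, x⟩ u hv
  rw [← hz]
  exact M.intervene_solve_of_mem ⟨S, x⟩ u s.2

end SCM

/-! ### Independence of the responses in the component of the target -/

namespace MeasureTheory

/-- Events that depend on disjoint sets of coordinates are independent under a product measure. -/
theorem Measure.pi_inter_eq_mul_of_dependsOn {ι : Type*} [Fintype ι] {α : ι → Type*}
    [∀ i, MeasurableSpace (α i)] (μ : ∀ i, Measure (α i)) [∀ i, IsProbabilityMeasure (μ i)]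
    {s t : Set ι} (hst : Disjoint s t) {A B : Set (∀ i, α i)}
    (hA : MeasurableSet A) (hB : MeasurableSet B)
    (hAs : DependsOn (· ∈ A) s) (hBt : DependsOn (· ∈ B) t) :
    Measure.pi μ (A ∩ B) = Measure.pi μ A * Measure.pi μ B := by
  classical
  -- an event depending on `s` only is measurable with respect to the coordinates in `s`:
  -- freeze the other coordinates at one of its points
  have key : ∀ (s : Set ι) (A : Set (∀ i, α i)), MeasurableSet A → DependsOn (· ∈ A) s →
      ∃ A' : Set (∀ i : s.toFinset, α i), MeasurableSet A' ∧
        A = (fun u (i : s.toFinset) => u i) ⁻¹' A' := by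
    intro s A hA hAs
    obtain rfl | ⟨u₀, -⟩ := A.eq_empty_or_nonempty
    · exact ⟨∅, .empty, rfl⟩
    refine ⟨{p | (fun i => if h : i ∈ s.toFinset then p ⟨i, h⟩ else u₀ i) ∈ A},
      hA.preimage (measurable_pi_lambda _ fun i => ?_), ?_⟩
    · by_cases h : i ∈ s.toFinset
      · simpa [h] using measurable_pi_apply (X := fun i : s.toFinset => α i) ⟨i, h⟩
      · simp [h]
    · ext u
      refine iff_of_eq (hAs fun i hi => ?_)
      simp [hi]
  obtain ⟨A', hA', rfl⟩ := key s A hA hAs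
  obtain ⟨B', hB', rfl⟩ := key t B hB hBt
  have hind : ProbabilityTheory.iIndepFun (fun i (u : ∀ i, α i) => u i) (Measure.pi μ) :=
    ProbabilityTheory.iIndepFun_pi (X := fun _ => id) fun _ => aemeasurable_id
  exact (hind.indepFun_finset s.toFinset t.toFinset (by simpa using hst)
    fun i => measurable_pi_apply i).measure_inter_preimage_eq_mul _ _ hA' hB'

end MeasureTheory

namespace SCM

variable {V : Type*} {Ω U : V → Type*} [∀ v, MeasurableSpace (Ω v)] [∀ v, MeasurableSpace (U v)]
  [∀ v, MeasurableSingletonClass (Ω v)] [Fintype V]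

instance isProbabilityMeasure_exo (M : SCM V Ω U) : IsProbabilityMeasure M.exo := by
  have := M.isProbabilityMeasure_law
  unfold exo
  infer_instance

/-- If `X_S = x` has positive probability and forces `X_y = c` almost surely, then `X_y = c` is
already forced by those of the constraints `X_s = x_s` that lie in the component `C` of `y`: the
remaining constraints are independent of them and of the response of `y`. -/
theorem ae_response_eq (M : SCM V Ω U) {S C T : Set V} {y : V} (hy : y ∈ C) (hS : S ⊆ C ∪ T)
    (hCT : Disjoint C T)
    (hC : ∀ v ∈ C, ∀ w, M.graph.Adj w v → w ∉ S → w ∈ C)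
    (hT : ∀ v ∈ T, ∀ w, M.graph.Adj w v → w ∉ S → w ∈ T)
    (x : ∀ s : S, Ω s) (hx : 0 < M.exo {u | ∀ s : S, M.solve u s = x s}) (c : Ω y)
    (hc : ∀ᵐ u ∂M.exo, (∀ s : S, M.solve u s = x s) → M.solve u y = c) :
    ∀ᵐ u ∂M.exo, (∀ s : S, (s : V) ∈ C → M.response x u s = x s) → M.response x u y = c := by
  have := M.isProbabilityMeasure_law
  let A : Set (∀ v, U v) :=
    {u | (∀ s : S, (s : V) ∈ C → M.response x u s = x s) ∧ M.response x u y ≠ c}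
  let B : Set (∀ v, U v) := {u | ∀ s : S, (s : V) ∈ T → M.response x u s = x s}
  have hmeas : ∀ v (d : Ω v), MeasurableSet {u | M.response x u v = d} := fun v d =>
    M.measurable_response x v (measurableSet_singleton d)
  have hmeas' : ∀ R : Set V,
      MeasurableSet {u | ∀ s : S, (s : V) ∈ R → M.response x u s = x s} := fun R => by
    simp only [Set.ofPred_forall]
    exact .iInter fun s => .iInter fun _ => hmeas s (x s)
  have hdep : ∀ R : Set V, (∀ v ∈ R, ∀ w, M.graph.Adj w v → w ∉ S → w ∈ R) →
      ∀ ⦃u u'⦄, (∀ i ∈ R, u i = u' i) → ∀ v ∈ R, M.response x u v = M.response x u' v :=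
    fun R hR u u' h v hv => M.dependsOn_response x hR hv h
  have hAB : M.exo (A ∩ B) = M.exo A * M.exo B := by
    refine Measure.pi_inter_eq_mul_of_dependsOn M.law hCT
      ((hmeas' C).inter (hmeas y c).compl) (hmeas' T) (fun u u' h => ?_) fun u u' h => ?_
    · refine propext (and_congr (forall_congr' fun s => forall_congr' fun hs => ?_) ?_)
      · rw [hdep C hC h s hs]
      · rw [hdep C hC h y hy]
    · refine propext (forall_congr' fun s => forall_congr' fun hs => ?_)
      rw [hdep T hT h s hs]
  have hAB0 : M.exo (A ∩ B) = 0 := by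
    refine measure_mono_null ?_ (ae_iff.1 hc)
    intro u hu hcu
    have hxS := M.solve_eq_of_response_eq x (u := u) fun s =>
      (hS s.2).elim (hu.1.1 s) (hu.2 s)
    exact hu.1.2 ((M.solve_eq_response x hxS y).symm.trans (hcu hxS))
  have hB : M.exo B ≠ 0 := by
    refine (hx.trans_le (measure_mono ?_)).ne'
    intro u hu s _
    rw [← M.solve_eq_response x hu, hu s]
  have hA : M.exo A = 0 := (mul_eq_zero.1 (hAB.symm.trans hAB0)).resolve_right hB
  refine ae_iff.2 ?_
  simpa only [Classical.not_imp] using hA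

end SCM

/-! ### Recourse -/

theorem proposition2 {D : Type*} [Fintype D] {Ω U : Option D → Type*}
    [∀ v, MeasurableSpace (Ω v)] [∀ v, MeasurableSingletonClass (Ω v)]
    [∀ v, MeasurableSpace (U v)] [Preorder (Ω none)]
    (M : SCM (Option D) Ω U) (𝔸 : Set (DoAction Ω))
    (f : (∀ d, Ω (some d)) → Ω none) (S : Set D)
    (hperfect : ∀ᵐ u ∂M.exo, f (features (M.solve u)) = M.solve u none)
    (hS : DependsOn f S)
    (hstable : M.graph.InterventionStable none (some '' S) (M.actionableCauses 𝔸)) :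
    ∀ᵐ uF ∂M.exo, ∀ inv : (∀ d, Ω (some d)) → ∀ v, U v,
      inv (features (M.solve uF)) = uF →
      ∀ (cost : DoAction Ω → (∀ d, Ω (some d)) → ℝ) (t : Ω none) (a : DoAction Ω),
        M.IsEARRecommendation 𝔸 cost f t inv (features (M.solve uF)) a →
        0 < M.exo {u | ∀ d ∈ S, features (M.solve u) d =
          features (M.counterfactual inv (features (M.solve uF)) a) d} →
        f (features (M.counterfactual inv (features (M.solve uF)) a)) =
          M.counterfactual inv (features (M.solve uF)) a none := by
  obtain ⟨R, hR⟩ : ∃ R : Set (Option D), R = some '' S := ⟨_, rfl⟩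
  rw [← hR] at hstable
  obtain ⟨C, T, hyC, hSCT, hCT, hLC, hC, hT⟩ :=
    hstable.exists_separation M.acyclic fun _ h => h.1
  -- Only countably many values of `X_S` have positive probability, so one null set serves all
  -- of them, and hence all actions.
  have hcount : {x : ∀ s : R, Ω s |
      0 < M.exo {u | (fun s : R => M.solve u s) = x}}.Countable :=
    Measure.countable_meas_level_set_pos
      (measurable_pi_lambda _ fun s => (measurable_pi_apply _).comp M.measurable_solve)
  have hae : ∀ᵐ u ∂M.exo, ∀ z : ∀ v, Ω v,
      0 < M.exo {u | ∀ s : R, M.solve u s = z s} →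
      (∀ s : R, (s : Option D) ∈ C →
        M.response (fun s : R => z s) u s = z s) →
      M.response (fun s : R => z s) u none = f (features z) := by
    have hatom := (ae_ball_iff hcount).2 fun x hx =>
      show ∀ᵐ u ∂M.exo, ∀ z : ∀ v, Ω v,
          (fun s : R => z s) = x →
          (∀ s : R, (s : Option D) ∈ C → M.response x u s = x s) →
          M.response x u none = f (features z) by
        rw [Set.mem_ofPred_eq] at hx
        obtain ⟨u₀, hu₀⟩ := nonempty_of_measure_ne_zero hx.ne'
        have hf : ∀ z : ∀ v, Ω v, (fun s : R => z s) = x →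
            f (features z) = f (features (M.solve u₀)) := fun z hz =>
          hS fun d hd => congrFun (hz.trans hu₀.symm) ⟨some d, hR ▸ ⟨d, hd, rfl⟩⟩
        filter_upwards [M.ae_response_eq hyC hSCT hCT hC hT x
          (by simpa only [funext_iff] using hx) (f (features (M.solve u₀)))
          (by filter_upwards [hperfect] with u hu hux using hu ▸ hf _ (funext hux))]
          with u hu z hz hzC
        rw [hf z hz]
        exact hu hzC
    filter_upwards [hatom] with u hu z hz
    exact hu _ (by simpa only [funext_iff] using hz) z rfl
  filter_upwards [hae] with uF huF inv hinv cost t a ha hpos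
  have hcf : M.counterfactual inv (features (M.solve uF)) a = (M.intervene a).solve uF := by
    rw [SCM.counterfactual, hinv]
  rw [hcf] at hpos ⊢
  set z := (M.intervene a).solve uF
  have hresp : ∀ v ∈ C,
      z v = M.response (fun s : R => z s) uF v := by
    refine M.eq_response _ hC (fun _ => rfl) fun v hv => M.intervene_solve_of_notMem a uF ?_
    exact fun hva => Set.disjoint_left.1 hLC ⟨ha.1.2.1 hva, a, ha.1.1, hva⟩ hv
  rw [hresp none hyC]
  refine (huF z ?_ fun s hs => (hresp s hs).symm).symm
  simpa [features, hR] using hpos
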